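/- Let $G \le \mathrm{PGL}_2(\mathbb{Z})$ be the subgroup generated by the classes of $m_1 = \begin{bmatrix} 1 & 0 \\ 2 & -1 \end{bmatrix}$, $m_2 = \begin{bmatrix} -1 & 2 \\ 0 & 1 \end{bmatrix}$, $m_3 = \begin{bmatrix} -1 & 0 \\ 0 & 1 \end{bmatrix}$ (the Markoff group). It is the free product of the three groups of order two generated by $m_1, m_2, m_3$. For a prime $p$, let $$M(\mathbb{F}_p) = \{(x,y,z) \in \mathbb{F}_p^3 : x^2+y^2+z^2 = xyz\} \setminus \{(0,0,0)\},$$ on which $G$ acts by $$m_1(x,y,z) = (yz-x,y,z), \quad m_2(x,y,z) = (x,xz-y,z), \quad m_3(x,y,z) = (x,y,xy-z).$$ Let $p$ be a prime and let $g \in G$, $g \ne 1$, be represented by a matrix $\begin{bmatrix} a & b \\ c & d \end{bmatrix} \in \mathrm{GL}_2(\mathbb{Z})$ with $$\max(|a|,|b|,|c|,|d|) \le (p/128)^{1/8}.$$ Then $g$ has at most $1024\, p \max(|a|,|b|,|c|,|d|)^8$ fixed points on $M(\mathbb{F}_p)$. -/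

import Mathlib

open Matrix

/-- The projective linear group `PGL₂(ℤ)`: the quotient of `GL₂(ℤ)` by its centre `{±1}`. -/
abbrev PGL2Z : Type := GL (Fin 2) ℤ ⧸ Subgroup.center (GL (Fin 2) ℤ)

/-- The matrices `[m₁], [m₂], [m₃]` (indexed by `0, 1, 2`) attached to the three Markoff moves. -/
def markoffMatrix : Fin 3 → Matrix (Fin 2) (Fin 2) ℤ
  | 0 => !![1, 0; 2, -1]
  | 1 => !![-1, 2; 0, 1]
  | 2 => !![-1, 0; 0, 1]

theorem markoffMatrix_mul_self (i : Fin 3) : markoffMatrix i * markoffMatrix i = 1 := by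
  fin_cases i <;> decide

/-- The matrices of the three Markoff moves as elements of `GL₂(ℤ)`. -/
def markoffGL (i : Fin 3) : GL (Fin 2) ℤ :=
  ⟨markoffMatrix i, markoffMatrix i, markoffMatrix_mul_self i, markoffMatrix_mul_self i⟩

/-- The Markoff group: the subgroup of `PGL₂(ℤ)` generated by the classes of
`[m₁], [m₂], [m₃]`. -/
def MarkoffGroup : Subgroup PGL2Z :=
  Subgroup.closure (Set.range fun i : Fin 3 => (markoffGL i : PGL2Z))

/-- The generator `mᵢ` of the Markoff group. -/
def markoffGen (i : Fin 3) : MarkoffGroup :=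
  ⟨(markoffGL i : PGL2Z), Subgroup.subset_closure ⟨i, rfl⟩⟩

/-- The nonzero solutions of the Markoff equation `x² + y² + z² = x y z` over `R`. -/
def MarkoffSurface (R : Type*) [CommRing R] : Type _ :=
  {v : R × R × R //
    v.1 ^ 2 + v.2.1 ^ 2 + v.2.2 ^ 2 = v.1 * v.2.1 * v.2.2 ∧ v ≠ (0, 0, 0)}

/-- The Vieta involutions `(yz - x, y, z)`, `(x, xz - y, z)`, `(x, y, xy - z)` of affine
three-space. -/
def vietaMap {R : Type*} [CommRing R] : Fin 3 → R × R × R → R × R × R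
  | 0, (x, y, z) => (y * z - x, y, z)
  | 1, (x, y, z) => (x, x * z - y, z)
  | 2, (x, y, z) => (x, y, x * y - z)

theorem vietaMap_vietaMap {R : Type*} [CommRing R] (i : Fin 3) (v : R × R × R) :
    vietaMap i (vietaMap i v) = v := by
  obtain ⟨x, y, z⟩ := v
  fin_cases i <;> simp [vietaMap]

theorem vietaMap_mem {R : Type*} [CommRing R] (i : Fin 3) (v : R × R × R)
    (hv : v.1 ^ 2 + v.2.1 ^ 2 + v.2.2 ^ 2 = v.1 * v.2.1 * v.2.2 ∧ v ≠ (0, 0, 0)) :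
    (vietaMap i v).1 ^ 2 + (vietaMap i v).2.1 ^ 2 + (vietaMap i v).2.2 ^ 2 =
      (vietaMap i v).1 * (vietaMap i v).2.1 * (vietaMap i v).2.2 ∧
    vietaMap i v ≠ (0, 0, 0) := by
  refine ⟨?_, fun h => hv.2 ?_⟩
  · obtain ⟨x, y, z⟩ := v
    have h := hv.1
    fin_cases i <;> simp only [vietaMap] at h ⊢ <;> linear_combination h
  · rw [← vietaMap_vietaMap i v, h]
    fin_cases i <;> simp [vietaMap]

/-- The Markoff move `mᵢ` as a permutation of the nonzero solutions of the Markoff equation. -/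
def markoffMove (R : Type*) [CommRing R] (i : Fin 3) : Equiv.Perm (MarkoffSurface R) where
  toFun v := ⟨vietaMap i v.1, vietaMap_mem i v.1 v.2⟩
  invFun v := ⟨vietaMap i v.1, vietaMap_mem i v.1 v.2⟩
  left_inv v := Subtype.ext (vietaMap_vietaMap i v.1)
  right_inv v := Subtype.ext (vietaMap_vietaMap i v.1)

theorem markoffMove_mul_self (R : Type*) [CommRing R] (i : Fin 3) :
    markoffMove R i * markoffMove R i = 1 :=
  Equiv.ext fun v => Subtype.ext (vietaMap_vietaMap i v.1)

/-- The homomorphism from the group of order two determined by an element of square one. -/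
def involutionHom {H : Type*} [Group H] (x : H) (hx : x * x = 1) :
    Multiplicative (ZMod 2) →* H where
  toFun k := x ^ (Multiplicative.toAdd k).val
  map_one' := by simp
  map_mul' := by
    intro a b
    have key : ∀ c d : ZMod 2, x ^ (c + d).val = x ^ c.val * x ^ d.val := by
      intro c d
      rw [← pow_add, ZMod.val_add, ← pow_eq_pow_mod _ (by rw [pow_two, hx])]
    exact key _ _

theorem involutionHom_ofAdd_one {H : Type*} [Group H] (x : H) (hx : x * x = 1) :
    involutionHom x hx (Multiplicative.ofAdd 1) = x := pow_one x

theorem markoffGen_mul_self (i : Fin 3) : markoffGen i * markoffGen i = 1 := by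
  apply Subtype.ext
  change ((markoffGL i * markoffGL i : GL (Fin 2) ℤ) : PGL2Z) = 1
  have : markoffGL i * markoffGL i = 1 := Units.ext (markoffMatrix_mul_self i)
  rw [this]; rfl

/-- `GL₂(ℤ)` acting on `2 × 2` integer matrices by `S ↦ g S gᵀ`. -/
def congrPermGL : GL (Fin 2) ℤ →* Equiv.Perm (Matrix (Fin 2) (Fin 2) ℤ) where
  toFun g :=
    { toFun := fun S => g.1 * S * g.1ᵀ
      invFun := fun S => (g⁻¹).1 * S * (g⁻¹).1ᵀ
      left_inv := fun S => by
        calc (g⁻¹).1 * (g.1 * S * g.1ᵀ) * (g⁻¹).1ᵀ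
            = ((g⁻¹).1 * g.1) * S * ((g⁻¹).1 * g.1)ᵀ := by
              simp only [Matrix.transpose_mul, Matrix.mul_assoc]
          _ = S := by rw [← Units.val_mul, inv_mul_cancel]; simp
      right_inv := fun S => by
        calc g.1 * ((g⁻¹).1 * S * (g⁻¹).1ᵀ) * g.1ᵀ
            = (g.1 * (g⁻¹).1) * S * (g.1 * (g⁻¹).1)ᵀ := by
              simp only [Matrix.transpose_mul, Matrix.mul_assoc]
          _ = S := by rw [← Units.val_mul, mul_inv_cancel]; simp }
  map_one' := by ext1 S; simp
  map_mul' g h := by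
    ext1 S
    simp [Matrix.mul_assoc]

/-- The induced action of `PGL₂(ℤ)`. -/
def congrPerm : PGL2Z →* Equiv.Perm (Matrix (Fin 2) (Fin 2) ℤ) :=
  QuotientGroup.lift _ congrPermGL fun g hg => by
    rw [Matrix.GeneralLinearGroup.mem_center_iff_val_mem_range_scalar] at hg
    obtain ⟨a, ha⟩ := hg
    have ha2 : a * a = 1 := by
      have h1 : IsUnit g.1.det := (Matrix.isUnit_iff_isUnit_det _).1 g.isUnit
      rw [← ha] at h1
      simp only [Matrix.scalar_apply, Matrix.det_diagonal, Fin.prod_univ_two] at h1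
      rcases Int.isUnit_iff.1 h1 with h | h
      · exact h
      · nlinarith [mul_self_nonneg a]
    ext1 S
    change g.1 * S * g.1ᵀ = S
    rw [← ha, Matrix.scalar_apply, Matrix.diagonal_transpose]
    ext i j
    rw [Matrix.mul_diagonal, Matrix.diagonal_mul]
    linear_combination (S i j) * ha2

/-- The condition cutting out the `i`-th of the three ping-pong regions. -/
def pingPongCond : Fin 3 → ℤ → ℤ → Prop
  | 0, u, w => 0 < u ∧ u < w
  | 1, u, w => 0 < w ∧ w < u
  | 2, u, w => u < 0 ∧ 0 < w

/-- The three ping-pong regions. -/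
def pingPongSet (i : Fin 3) : Set (Matrix (Fin 2) (Fin 2) ℤ) :=
  {S | ∃ u w : ℤ, pingPongCond i u w ∧ S = !![u * u, u * w; w * u, w * w]}

/-- The Markoff group is the free product of the three groups of order two generated by
`m₁, m₂, m₃`. -/
theorem markoffGroup_freeProduct_injective :
    Function.Injective (Monoid.CoprodI.lift fun i : Fin 3 =>
      involutionHom (markoffGen i) (markoffGen_mul_self i)) := by
  set F := Monoid.CoprodI.lift fun i : Fin 3 =>
      involutionHom (markoffGen i) (markoffGen_mul_self i)
  let ψ : MarkoffGroup →* Equiv.Perm (Matrix (Fin 2) (Fin 2) ℤ) :=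
    congrPerm.comp MarkoffGroup.subtype
  let f : ∀ i : Fin 3, Multiplicative (ZMod 2) →* Equiv.Perm (Matrix (Fin 2) (Fin 2) ℤ) :=
    fun i => ψ.comp (involutionHom (markoffGen i) (markoffGen_mul_self i))
  have key : Function.Injective (Monoid.CoprodI.lift f) := by
    apply Monoid.CoprodI.lift_injective_of_ping_pong f (Or.inl (by simp)) pingPongSet
    · intro i
      fin_cases i
      · exact ⟨_, 1, 2, by simp [pingPongCond], rfl⟩
      · exact ⟨_, 2, 1, by simp [pingPongCond], rfl⟩
      · exact ⟨_, -1, 1, by simp [pingPongCond], rfl⟩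
    · intro i j hij
      rw [Function.onFun, Set.disjoint_left]
      rintro S ⟨u, w, h, rfl⟩ ⟨u', w', h', hS⟩
      have h00 := congrFun (congrFun hS 0) 0
      have h01 := congrFun (congrFun hS 0) 1
      have h11 := congrFun (congrFun hS 1) 1
      simp at h00 h01 h11
      fin_cases i <;> fin_cases j <;> simp [pingPongCond] at h h' hij <;>
        obtain ⟨h1, h2⟩ := h <;> obtain ⟨h3, h4⟩ := h' <;> nlinarith
    · intro i j hij k hk
      have hk1 : k = Multiplicative.ofAdd 1 := by
        revert hk; revert k; decide
      subst hk1
      rintro _ ⟨S, ⟨u, w, h, rfl⟩, rfl⟩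
      have hf : f i (Multiplicative.ofAdd 1) = congrPermGL (markoffGL i) := by
        change ψ (involutionHom (markoffGen i) (markoffGen_mul_self i) _) = _
        rw [involutionHom_ofAdd_one]
        rfl
      simp only [hf]
      change markoffMatrix i * _ * (markoffMatrix i)ᵀ ∈ _
      fin_cases i <;> fin_cases j <;> simp [pingPongCond] at h hij
      · exact ⟨u, 2 * u - w, ⟨by lia, by lia⟩, by
          ext a b; fin_cases a <;> fin_cases b <;>
            simp [markoffMatrix, Matrix.mul_apply, Fin.sum_univ_two] <;> ring⟩
      · exact ⟨-u, -(2 * u - w), ⟨by lia, by lia⟩, by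
          ext a b; fin_cases a <;> fin_cases b <;>
            simp [markoffMatrix, Matrix.mul_apply, Fin.sum_univ_two] <;> ring⟩
      · exact ⟨-u + 2 * w, w, ⟨by lia, by lia⟩, by
          ext a b; fin_cases a <;> fin_cases b <;>
            simp [markoffMatrix, Matrix.mul_apply, Fin.sum_univ_two] <;> ring⟩
      · exact ⟨-u + 2 * w, w, ⟨by lia, by lia⟩, by
          ext a b; fin_cases a <;> fin_cases b <;>
            simp [markoffMatrix, Matrix.mul_apply, Fin.sum_univ_two] <;> ring⟩
      · exact ⟨-u, w, ⟨by lia, by lia⟩, by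
          ext a b; fin_cases a <;> fin_cases b <;>
            simp [markoffMatrix, Matrix.mul_apply, Fin.sum_univ_two]⟩
      · exact ⟨-u, w, ⟨by lia, by lia⟩, by
          ext a b; fin_cases a <;> fin_cases b <;>
            simp [markoffMatrix, Matrix.mul_apply, Fin.sum_univ_two]⟩
  have hcomp : ψ.comp F = Monoid.CoprodI.lift f := by
    refine Monoid.CoprodI.ext_hom _ _ fun i => MonoidHom.ext fun k => ?_
    simp [F, f]
  intro a b hab
  apply key
  rw [← hcomp]
  simp [hab]

/-- Homomorphisms out of the Markoff group agree once they agree on `m₁, m₂, m₃`. -/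
theorem markoffGroup_hom_ext {H : Type*} [Monoid H] {φ ψ : MarkoffGroup →* H}
    (h : ∀ i, φ (markoffGen i) = ψ (markoffGen i)) : φ = ψ := by
  have hcl : Subgroup.closure (Set.range markoffGen) = ⊤ := by
    have h0 := Subgroup.closure_closure_coe_preimage
      (k := Set.range fun i : Fin 3 => (markoffGL i : PGL2Z))
    refine Eq.trans (congrArg _ ?_) h0
    ext x
    constructor
    · rintro ⟨i, rfl⟩; exact ⟨i, rfl⟩
    · rintro ⟨i, hi⟩; exact ⟨i, Subtype.ext hi⟩
  refine MonoidHom.eq_of_eqOn_dense hcl ?_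
  rintro _ ⟨i, rfl⟩
  exact h i

theorem markoffGroup_freeProduct_surjective :
    Function.Surjective (Monoid.CoprodI.lift fun i : Fin 3 =>
      involutionHom (markoffGen i) (markoffGen_mul_self i)) := by
  rintro ⟨g, hg⟩
  induction hg using Subgroup.closure_induction with
  | mem x hx =>
    obtain ⟨i, rfl⟩ := hx
    exact ⟨Monoid.CoprodI.of (i := i) (Multiplicative.ofAdd 1), by
      rw [Monoid.CoprodI.lift_of, involutionHom_ofAdd_one]; rfl⟩
  | one => exact ⟨1, map_one _⟩
  | mul x y hx hy ihx ihy =>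
    obtain ⟨a, ha⟩ := ihx
    obtain ⟨b, hb⟩ := ihy
    exact ⟨a * b, by rw [map_mul, ha, hb]; rfl⟩
  | inv x hx ih =>
    obtain ⟨a, ha⟩ := ih
    exact ⟨a⁻¹, by rw [map_inv, ha]; rfl⟩

/-- The free product decomposition `ℤ/2 * ℤ/2 * ℤ/2 ≃ G` of the Markoff group `G`. -/
noncomputable def markoffFreeProductEquiv :
    (Monoid.CoprodI fun _ : Fin 3 => Multiplicative (ZMod 2)) ≃* MarkoffGroup :=
  MulEquiv.ofBijective
    (Monoid.CoprodI.lift fun i : Fin 3 =>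
      involutionHom (markoffGen i) (markoffGen_mul_self i))
    (And.intro markoffGroup_freeProduct_injective markoffGroup_freeProduct_surjective :
      Function.Bijective _)

/-- The action of the Markoff group on the nonzero solutions of the Markoff equation over `R`:
the homomorphism that sends each generator `mᵢ` to the corresponding Markoff move
(see `markoffAction_markoffGen`; by `markoffGroup_hom_ext` it is the only one). -/
noncomputable def markoffAction (R : Type*) [CommRing R] :
    MarkoffGroup →* Equiv.Perm (MarkoffSurface R) :=
  (Monoid.CoprodI.lift fun i : Fin 3 =>
      involutionHom (markoffMove R i) (markoffMove_mul_self R i)).comp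
    markoffFreeProductEquiv.symm.toMonoidHom

theorem markoffAction_markoffGen (R : Type*) [CommRing R] (i : Fin 3) :
    markoffAction R (markoffGen i) = markoffMove R i := by
  have h : markoffFreeProductEquiv.symm (markoffGen i) =
      Monoid.CoprodI.of (i := i) (Multiplicative.ofAdd 1) := by
    rw [MulEquiv.symm_apply_eq]
    have h1 : Monoid.CoprodI.lift (fun i : Fin 3 =>
        involutionHom (markoffGen i) (markoffGen_mul_self i))
          (Monoid.CoprodI.of (i := i) (Multiplicative.ofAdd 1)) = markoffGen i := by
      rw [Monoid.CoprodI.lift_of, involutionHom_ofAdd_one]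
    exact h1.symm
  change Monoid.CoprodI.lift (fun i : Fin 3 =>
    involutionHom (markoffMove R i) (markoffMove_mul_self R i))
      (markoffFreeProductEquiv.symm (markoffGen i)) = _
  rw [h, Monoid.CoprodI.lift_of, involutionHom_ofAdd_one]

/-- The largest absolute value of an entry of a `2 × 2` integer matrix. -/
def maxEntry (A : Matrix (Fin 2) (Fin 2) ℤ) : ℤ :=
  max (max |A 0 0| |A 0 1|) (max |A 1 0| |A 1 1|)

/-! Write `g` as a reduced word and pick an index `j` different from the letter that acts first.
Points with nonzero coordinates and fixed ratio `c = v (j + 2) / v (j + 1)` form a rational curve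
with parameter `w = v j / v (j + 1)`, along which the coordinates grow like `w ^ d k` as `w → ∞`,
with `d j = 2` and the other weights `1`. A Vieta move at an index not carrying the largest weight
replaces that weight by the sum of the other two, so in a reduced word no leading term cancels and
the largest weight strictly increases (`reduced_word_growth`). Hence being fixed by `g` is a
nontrivial polynomial equation in `w` for each `c`.

The degree is controlled by the matrix: the weights transform as the absolute values of `u 1`, `u
0`, `u 0 - u 1` at a vector `u` moved by the matrices of the word (`slopeLength_markoffMatrix`), so
the final weights are at most `6 M`, where `M` is the largest entry. This gives at most `12 M` roots
for each `c` (`ncard_fixedPoints_ne_zero_le`). Points with a zero coordinate add at most `6 q` over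
a field of `q` elements (`ncard_coord_eq_zero_le`), and `(12 M + 6) q ≤ 1024 q M ^ 8` because `M ≥
1`. -/

open Polynomial in
/-- A set fibred over a finite field, each fibre of which embeds into the zeros of a nonzero
polynomial of degree at most `n`, has at most `n * #F` elements. -/
theorem ncard_le_of_fibre_roots {α F : Type*} [Field F] [Fintype F] [Finite α] (S : Set α)
    (f h : α → F) (hinj : S.InjOn fun a => (f a, h a)) (n : ℕ)
    (H : ∀ b, ∃ Q : F[X], Q ≠ 0 ∧ Q.natDegree ≤ n ∧ ∀ a ∈ S, f a = b → Q.eval (h a) = 0) :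
    S.ncard ≤ n * Fintype.card F := by
  classical
  choose Q hQ0 hQn hQ using H
  let T : Finset (F × F) := Finset.univ.biUnion fun b => (Q b).roots.toFinset.image fun w => (b, w)
  have hT : T.card ≤ Fintype.card F * n := by
    refine Finset.card_biUnion_le_card_mul _ _ _ fun b _ => ?_
    exact Finset.card_image_le.trans
      ((Multiset.toFinset_card_le _).trans ((card_roots' _).trans (hQn b)))
  calc S.ncard ≤ (T : Set (F × F)).ncard := by
        refine Set.ncard_le_ncard_of_injOn _ (fun a ha => ?_) hinj (Finset.finite_toSet T)
        simp only [T, Finset.coe_biUnion, Set.mem_iUnion, Finset.coe_image, Set.mem_image,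
          Finset.mem_coe, Multiset.mem_toFinset]
        exact ⟨f a, Finset.mem_univ _, h a, (mem_roots (hQ0 _)).2 (hQ _ a ha rfl), rfl⟩
    _ ≤ n * Fintype.card F := by rw [Set.ncard_coe_finset, mul_comm]; exact hT

/-! ### Cyclic coordinates and reduced words -/

/-- The three coordinates of a triple as a function on `Fin 3`. -/
def tripleCoord {R : Type*} (v : R × R × R) : Fin 3 → R := ![v.1, v.2.1, v.2.2]

theorem tripleCoord_injective {R : Type*} :
    Function.Injective (tripleCoord : R × R × R → Fin 3 → R) := by
  intro v w h
  have h0 := congrFun h 0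
  have h1 := congrFun h 1
  have h2 := congrFun h 2
  exact Prod.ext h0 (Prod.ext h1 h2)

/-- The Vieta involutions in cyclically indexed coordinates. -/
def vietaFun {R : Type*} [CommRing R] (i : Fin 3) (v : Fin 3 → R) : Fin 3 → R :=
  Function.update v i (v (i + 1) * v (i + 2) - v i)

theorem tripleCoord_vietaMap {R : Type*} [CommRing R] (i : Fin 3) (v : R × R × R) :
    tripleCoord (vietaMap i v) = vietaFun i (tripleCoord v) := by
  obtain ⟨x, y, z⟩ := v
  ext k
  fin_cases i <;> fin_cases k <;> simp [tripleCoord, vietaMap, vietaFun, mul_comm]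

theorem tripleCoord_equation {R : Type*} [CommRing R] (v : MarkoffSurface R) (j : Fin 3) :
    tripleCoord v.1 j ^ 2 + tripleCoord v.1 (j + 1) ^ 2 + tripleCoord v.1 (j + 2) ^ 2 =
      tripleCoord v.1 j * tripleCoord v.1 (j + 1) * tripleCoord v.1 (j + 2) := by
  obtain ⟨⟨x, y, z⟩, h, -⟩ := v
  fin_cases j <;> simp [tripleCoord] at h ⊢ <;> linear_combination h

theorem markoffAction_list_prod {R : Type*} [CommRing R] (l : List (Fin 3))
    (v : MarkoffSurface R) :
    tripleCoord (markoffAction R (l.map markoffGen).prod v).1 =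
      l.foldr vietaFun (tripleCoord v.1) := by
  induction l with
  | nil => simp
  | cons i l ih =>
    rw [List.map_cons, List.prod_cons, map_mul, markoffAction_markoffGen, List.foldr_cons, ← ih]
    exact tripleCoord_vietaMap i _

/-- Every element of the Markoff group is a reduced word in the generators. -/
theorem markoffGroup_exists_reduced (g : MarkoffGroup) :
    ∃ l : List (Fin 3), l.IsChain (· ≠ ·) ∧ g = (l.map markoffGen).prod := by
  have step : ∀ (i : Fin 3) (h : MarkoffGroup),
      (∃ l : List (Fin 3), l.IsChain (· ≠ ·) ∧ h = (l.map markoffGen).prod) →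
      ∃ l : List (Fin 3), l.IsChain (· ≠ ·) ∧ markoffGen i * h = (l.map markoffGen).prod := by
    rintro i h ⟨l, hl, rfl⟩
    rcases l with _ | ⟨j, l⟩
    · exact ⟨[i], by simp, by simp⟩
    · by_cases hij : i = j
      · subst hij
        refine ⟨l, hl.tail, ?_⟩
        rw [List.map_cons, List.prod_cons, ← mul_assoc, markoffGen_mul_self, one_mul]
      · exact ⟨i :: j :: l, List.isChain_cons_cons.2 ⟨hij, hl⟩, by simp⟩
  obtain ⟨g, hg⟩ := g
  induction hg using Subgroup.closure_induction_left with
  | one => exact ⟨[], by simp, rfl⟩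
  | mul_left x hx y hy ih =>
    obtain ⟨i, rfl⟩ := hx
    exact step i _ ih
  | inv_mul_cancel x hx y hy ih =>
    obtain ⟨i, rfl⟩ := hx
    have : (markoffGen i)⁻¹ = markoffGen i := inv_eq_of_mul_eq_one_left (markoffGen_mul_self i)
    have h := step i _ ih
    rw [← this] at h
    exact h

/-! ### Growth of weights -/

theorem eq_add_one_or_eq_add_two_of_ne {i j : Fin 3} (h : i ≠ j) : i = j + 1 ∨ i = j + 2 := by
  revert i j; decide

/-- Replace the `i`-th entry by the sum of the two others. -/
def sumStep (i : Fin 3) (d : Fin 3 → ℕ) : Fin 3 → ℕ :=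
  Function.update d i (d (i + 1) + d (i + 2))

/-- A triple of positive weights whose `j`-th entry is the sum of the two others. -/
structure IsSumTriple (j : Fin 3) (d : Fin 3 → ℕ) : Prop where
  pos : ∀ k, 0 < d k
  sum : d j = d (j + 1) + d (j + 2)

theorem IsSumTriple.sumStep {i j : Fin 3} {d : Fin 3 → ℕ} (h : IsSumTriple j d) :
    IsSumTriple i (sumStep i d) := by
  have h1 : i + 1 ≠ i := by revert i; decide
  have h2 : i + 2 ≠ i := by revert i; decide
  refine ⟨fun k => ?_, by simp [_root_.sumStep, h1, h2]⟩
  by_cases hk : k = i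
  · subst hk
    simp [_root_.sumStep, h.pos]
  · simpa [_root_.sumStep, hk] using h.pos k

theorem IsSumTriple.le {j : Fin 3} {d : Fin 3 → ℕ} (h : IsSumTriple j d) (k : Fin 3) :
    d k ≤ d j := by
  have := h.sum
  by_cases hk : k = j
  · rw [hk]
  · rcases eq_add_one_or_eq_add_two_of_ne hk with rfl | rfl <;> lia

/-- As `i ≠ j`, the new entry is `d j` plus the remaining entry, which is positive. -/
theorem IsSumTriple.lt_sumStep {i j : Fin 3} {d : Fin 3 → ℕ} (h : IsSumTriple j d)
    (hij : i ≠ j) : d j < _root_.sumStep i d i := by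
  have h1 : ∀ j : Fin 3, j + 1 + 1 = j + 2 := by decide
  have h2 : ∀ j : Fin 3, j + 1 + 2 = j := by decide
  have h3 : ∀ j : Fin 3, j + 2 + 1 = j := by decide
  have h4 : ∀ j : Fin 3, j + 2 + 2 = j + 1 := by decide
  have hp1 := h.pos (j + 1)
  have hp2 := h.pos (j + 2)
  rcases eq_add_one_or_eq_add_two_of_ne hij with rfl | rfl <;>
    simp only [_root_.sumStep, Function.update_self, h1, h2, h3, h4] <;> lia

/-! ### Numerators of the coordinates along a word -/

open Polynomial in
/-- The Vieta involution on the numerators of a triple of fractions with denominators `X ^ d k`. -/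
noncomputable def numeratorStep {F : Type*} [Field F] (i : Fin 3) (d : Fin 3 → ℕ)
    (P : Fin 3 → F[X]) : Fin 3 → F[X] :=
  Function.update P i
    (P (i + 1) * P (i + 2) - X ^ (d (i + 1) + d (i + 2) - d i) * P i)

-- The product has degree `2 * (d (i + 1) + d (i + 2))` and the subtracted term `d (i + 1) + d (i +
-- 2) + d i`. The latter is smaller because `d i` is below the sum of the other two weights when `i
-- ≠ j`, so the leading terms cannot cancel.
open Polynomial in
theorem natDegree_numeratorStep {F : Type*} [Field F] {i j : Fin 3} {d : Fin 3 → ℕ}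
    {P : Fin 3 → F[X]} (hd : IsSumTriple j d) (hij : i ≠ j)
    (hP : ∀ k, (P k).natDegree = 2 * d k) (k : Fin 3) :
    (numeratorStep i d P k).natDegree = 2 * sumStep i d k := by
  have hlt : d i < d (i + 1) + d (i + 2) := by
    have h := hd.lt_sumStep hij
    simp only [sumStep, Function.update_self] at h
    exact (hd.le i).trans_lt h
  have h0 : ∀ k, P k ≠ 0 := fun k h => by
    have h1 := hP k
    have h2 := hd.pos k
    rw [h, natDegree_zero] at h1
    lia
  by_cases hk : k = i
  · subst hk
    simp only [numeratorStep, sumStep, Function.update_self]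
    have hprod : (P (k + 1) * P (k + 2)).natDegree = 2 * (d (k + 1) + d (k + 2)) := by
      rw [natDegree_mul (h0 _) (h0 _), hP, hP]; ring
    rw [natDegree_sub_eq_left_of_natDegree_lt, hprod]
    rw [hprod, natDegree_mul (pow_ne_zero _ X_ne_zero) (h0 _), natDegree_X_pow, hP]
    lia
  · simp only [numeratorStep, sumStep, Function.update_of_ne hk, hP]

open Polynomial in
theorem eval_numeratorStep {F : Type*} [Field F] {i j : Fin 3} {d : Fin 3 → ℕ}
    {P : Fin 3 → F[X]} (hd : IsSumTriple j d) (hij : i ≠ j) {w : F} {v : Fin 3 → F}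
    (hv : ∀ k, w ^ d k * v k = (P k).eval w) (k : Fin 3) :
    w ^ sumStep i d k * vietaFun i v k = (numeratorStep i d P k).eval w := by
  have hle : d i ≤ d (i + 1) + d (i + 2) := by
    have h := hd.lt_sumStep hij
    simp only [sumStep, Function.update_self] at h
    exact ((hd.le i).trans_lt h).le
  by_cases hk : k = i
  · subst hk
    simp only [numeratorStep, sumStep, vietaFun, Function.update_self, eval_sub, eval_mul,
      eval_pow, eval_X, ← hv]
    obtain ⟨e, he⟩ := Nat.exists_eq_add_of_le hle
    have hk : w ^ (d (k + 1) + d (k + 2)) * v k = w ^ e * (w ^ d k * v k) := by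
      rw [he, pow_add]
      ring
    rw [mul_sub, hk, he, Nat.add_sub_cancel_left, ← he, pow_add]
    ring
  · simp only [numeratorStep, sumStep, vietaFun, Function.update_of_ne hk, hv]

/-! ### Weights read off from the matrix -/

/-- The absolute values at `u` of the three linear forms permuted, up to sign, by `GL₂(ℤ)`
modulo its level two congruence subgroup. -/
def slopeLength (u : Fin 2 → ℤ) : Fin 3 → ℤ := ![|u 1|, |u 0|, |u 0 - u 1|]

/-- Up to sign, each of the three forms is a sum or difference of the other two. The matrix of move
`i` preserves two of them up to sign and exchanges sum and difference in the third. Since `i ≠ j`,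
`d i` is the difference of the other two lengths, so it becomes their sum. -/
theorem slopeLength_markoffMatrix {i j : Fin 3} {d : Fin 3 → ℕ} (hd : IsSumTriple j d)
    (hij : i ≠ j) {u : Fin 2 → ℤ} (hu : ∀ k, (d k : ℤ) = slopeLength u k) (k : Fin 3) :
    (sumStep i d k : ℤ) = slopeLength (markoffMatrix i *ᵥ u) k := by
  have h0 := hu 0
  have h1 := hu 1
  have h2 := hu 2
  have hs := hd.sum
  have hp := hd.pos
  simp only [slopeLength, Matrix.cons_val] at h0 h1 h2
  fin_cases i <;> fin_cases j <;> simp at hij <;> fin_cases k <;>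
    simp [sumStep, slopeLength, markoffMatrix, Matrix.mulVec, dotProduct,
      Fin.sum_univ_two] at hs ⊢ <;> grind

open Polynomial in
/-- Along a reduced word the weights grow, and remain the degrees of the numerators and the
slope lengths of the image of the initial vector. -/
theorem reduced_word_growth {F : Type*} [Field F] {j : Fin 3} {d : Fin 3 → ℕ}
    {P : Fin 3 → F[X]} {u : Fin 2 → ℤ} (hd : IsSumTriple j d)
    (hP : ∀ k, (P k).natDegree = 2 * d k) (hu : ∀ k, (d k : ℤ) = slopeLength u k)
    (l : List (Fin 3)) (i : Fin 3) (hl : (i :: l ++ [j]).IsChain (· ≠ ·)) :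
    ∃ (e : Fin 3 → ℕ) (Q : Fin 3 → F[X]), IsSumTriple i e ∧ d j < e i ∧
      (∀ k, (Q k).natDegree = 2 * e k) ∧
      (∀ k, (e k : ℤ) = slopeLength (((i :: l).map markoffMatrix).prod *ᵥ u) k) ∧
      ∀ (w : F) (v : Fin 3 → F), (∀ k, w ^ d k * v k = (P k).eval w) →
        ∀ k, w ^ e k * (i :: l).foldr vietaFun v k = (Q k).eval w := by
  induction l generalizing i with
  | nil =>
    have hij : i ≠ j := by simpa using hl
    exact ⟨sumStep i d, numeratorStep i d P, hd.sumStep, hd.lt_sumStep hij,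
      natDegree_numeratorStep hd hij hP,
      by simpa using slopeLength_markoffMatrix hd hij hu,
      fun w v hv => eval_numeratorStep hd hij hv⟩
  | cons a l ih =>
    rw [List.cons_append, List.cons_append, List.isChain_cons_cons] at hl
    obtain ⟨hia, hl⟩ := hl
    obtain ⟨e, Q, he, hlt, hQ, hu', hv⟩ := ih a hl
    refine ⟨sumStep i e, numeratorStep i e Q, he.sumStep, hlt.trans (he.lt_sumStep hia),
      natDegree_numeratorStep he hia hQ, fun k => ?_, fun w v h => ?_⟩
    · rw [slopeLength_markoffMatrix he hia hu' k, List.map_cons (l := a :: l), List.prod_cons,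
        Matrix.mulVec_mulVec]
    · exact eval_numeratorStep he hia (hv w v h)

/-! ### The initial parametrized curve -/

/-- The initial weights. -/
def initialWeight (j : Fin 3) : Fin 3 → ℕ := Function.update (fun _ => 1) j 2

theorem isSumTriple_initialWeight (j : Fin 3) : IsSumTriple j (initialWeight j) := by
  constructor <;> revert j <;> decide

/-- A vector whose slope lengths are the initial weights. -/
def initialVector : Fin 3 → Fin 2 → ℤ
  | 0 => ![1, 2]
  | 1 => ![2, 1]
  | 2 => ![-1, 1]

theorem initialWeight_eq_slopeLength (j k : Fin 3) :
    (initialWeight j k : ℤ) = slopeLength (initialVector j) k := by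
  revert j k; decide

open Polynomial in
/-- Numerators of the parametrization `w ↦ (w * x, x, c * x)`, with `x = (w² + c² + 1) / (c * w)`,
of the points of the Markoff surface with a given ratio `c` of two of the coordinates. -/
noncomputable def initialNumerator {F : Type*} [Field F] (c : F) (j : Fin 3) : Fin 3 → F[X] :=
  fun k =>
    if k = j then C c⁻¹ * (X ^ 2 * (X ^ 2 + C (1 + c ^ 2)))
    else if k = j + 1 then C c⁻¹ * (X ^ 2 + C (1 + c ^ 2))
    else X ^ 2 + C (1 + c ^ 2)

open Polynomial in
theorem natDegree_initialNumerator {F : Type*} [Field F] {c : F} (hc : c ≠ 0) (j k : Fin 3) :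
    (initialNumerator c j k).natDegree = 2 * initialWeight j k := by
  have hc' : c⁻¹ ≠ 0 := inv_ne_zero hc
  have h2 : (X ^ 2 + C (1 + c ^ 2) : F[X]).natDegree = 2 := natDegree_X_pow_add_C
  have h20 : (X ^ 2 + C (1 + c ^ 2) : F[X]) ≠ 0 := fun h => by
    rw [h, natDegree_zero] at h2
    exact two_ne_zero h2.symm
  unfold initialNumerator initialWeight
  by_cases hk : k = j
  · rw [if_pos hk, hk, Function.update_self, natDegree_C_mul hc',
      natDegree_mul (pow_ne_zero _ X_ne_zero) h20, h2, natDegree_X_pow]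
  · rw [if_neg hk, Function.update_of_ne hk]
    split_ifs
    · rw [natDegree_C_mul hc', h2]
    · exact h2

open Polynomial in
theorem eval_initialNumerator {F : Type*} [Field F] (j : Fin 3) {v : Fin 3 → F}
    (h0 : ∀ k, v k ≠ 0)
    (hv : v j ^ 2 + v (j + 1) ^ 2 + v (j + 2) ^ 2 = v j * v (j + 1) * v (j + 2)) (k : Fin 3) :
    (v j / v (j + 1)) ^ initialWeight j k * v k =
      (initialNumerator (v (j + 2) / v (j + 1)) j k).eval (v j / v (j + 1)) := by
  have hj := h0 j
  have h1 := h0 (j + 1)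
  have h2 := h0 (j + 2)
  unfold initialNumerator initialWeight
  by_cases hk : k = j
  · subst hk
    simp
    field_simp
    linear_combination (-1) * hv
  · rw [if_neg hk, Function.update_of_ne hk]
    rcases eq_add_one_or_eq_add_two_of_ne hk with rfl | rfl
    · simp
      field_simp
      linear_combination (-1) * hv
    · have : j + 2 ≠ j + 1 := by
        clear * -
        revert j
        decide
      simp [this]
      field_simp
      linear_combination (-1) * hv

/-! ### Matrix entries -/

theorem abs_entry_le_maxEntry (A : Matrix (Fin 2) (Fin 2) ℤ) (i j : Fin 2) :
    |A i j| ≤ maxEntry A := by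
  fin_cases i <;> fin_cases j <;> simp [maxEntry]

theorem one_le_maxEntry (A : GL (Fin 2) ℤ) : 1 ≤ maxEntry (A : Matrix (Fin 2) (Fin 2) ℤ) := by
  by_contra h
  have h0 : (A : Matrix (Fin 2) (Fin 2) ℤ) = 0 := by
    ext i j
    have := abs_entry_le_maxEntry A.1 i j
    have h1 : |A.1 i j| ≤ 0 := by lia
    simpa using h1
  exact A.ne_zero h0

/-- Invertible integer scalars are `±1`, so any representative may be replaced by the product of the
generator matrices along a word. -/
theorem maxEntry_eq_of_mk_eq {A B : GL (Fin 2) ℤ} (h : (A : PGL2Z) = (B : PGL2Z)) :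
    maxEntry (A : Matrix (Fin 2) (Fin 2) ℤ) = maxEntry (B : Matrix (Fin 2) (Fin 2) ℤ) := by
  have hc := QuotientGroup.eq.1 h
  rw [Matrix.GeneralLinearGroup.mem_center_iff_val_mem_range_scalar] at hc
  obtain ⟨a, ha⟩ := hc
  have hB : B.1 = A.1 * Matrix.scalar (Fin 2) a := by
    rw [ha, ← Units.val_mul, mul_inv_cancel_left]
  have hu : IsUnit (Matrix.scalar (Fin 2) a).det := by
    rw [ha]
    exact (Matrix.isUnit_iff_isUnit_det _).1 (A⁻¹ * B).isUnit
  have ha1 : |a| = 1 := by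
    rw [Matrix.scalar_apply, Matrix.det_diagonal, Fin.prod_univ_two] at hu
    exact Int.isUnit_iff_abs_eq.1 (isUnit_of_mul_isUnit_left hu)
  have hent : ∀ i j, |B.1 i j| = |A.1 i j| := fun i j => by
    rw [hB, Matrix.scalar_apply, Matrix.mul_diagonal, abs_mul, ha1, mul_one]
  simp only [maxEntry, hent]

/-- The entries of an initial vector have absolute values `1` and `2`, so each coordinate of the
image is at most `3 * maxEntry B` in absolute value, and their difference at most twice that. -/
theorem slopeLength_le (B : Matrix (Fin 2) (Fin 2) ℤ) (j k : Fin 3) :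
    slopeLength (B *ᵥ initialVector j) k ≤ 6 * maxEntry B := by
  have h00 := abs_le.1 (abs_entry_le_maxEntry B 0 0)
  have h01 := abs_le.1 (abs_entry_le_maxEntry B 0 1)
  have h10 := abs_le.1 (abs_entry_le_maxEntry B 1 0)
  have h11 := abs_le.1 (abs_entry_le_maxEntry B 1 1)
  fin_cases j <;> fin_cases k <;>
    simp [slopeLength, initialVector, Matrix.mulVec, dotProduct, Fin.sum_univ_two, abs_le] <;>
    constructor <;> linarith

theorem mk_prod_markoffGL (l : List (Fin 3)) :
    (((l.map markoffGL).prod : GL (Fin 2) ℤ) : PGL2Z) =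
      (((l.map markoffGen).prod : MarkoffGroup) : PGL2Z) := by
  induction l with
  | nil => rfl
  | cons i l ih =>
    rw [List.map_cons, List.prod_cons, List.map_cons, List.prod_cons, QuotientGroup.mk_mul, ih]
    rfl

theorem coe_prod_markoffGL (l : List (Fin 3)) :
    ((l.map markoffGL).prod : GL (Fin 2) ℤ).1 = (l.map markoffMatrix).prod := by
  induction l with
  | nil => rfl
  | cons i l ih =>
    rw [List.map_cons, List.prod_cons, List.map_cons, List.prod_cons, Units.val_mul, ih]
    rfl

/-! ### Counting points -/

instance markoffSurface_finite (R : Type*) [CommRing R] [Finite R] : Finite (MarkoffSurface R) :=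
  inferInstanceAs (Finite {v : R × R × R //
    v.1 ^ 2 + v.2.1 ^ 2 + v.2.2 ^ 2 = v.1 * v.2.1 * v.2.2 ∧ v ≠ (0, 0, 0)})

theorem markoffSurface_ext {R : Type*} [CommRing R] (j : Fin 3) {v w : MarkoffSurface R}
    (h0 : tripleCoord v.1 j = tripleCoord w.1 j)
    (h1 : tripleCoord v.1 (j + 1) = tripleCoord w.1 (j + 1))
    (h2 : tripleCoord v.1 (j + 2) = tripleCoord w.1 (j + 2)) : v = w := by
  refine Subtype.ext (tripleCoord_injective (funext fun k => ?_))
  by_cases hk : k = j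
  · rw [hk, h0]
  · rcases eq_add_one_or_eq_add_two_of_ne hk with rfl | rfl <;> assumption

-- With one coordinate zero the equation becomes `y ^ 2 + z ^ 2 = 0`, which leaves at most two `z`
-- for each `y`.
open Polynomial in
theorem ncard_coord_eq_zero_le (F : Type*) [Field F] [Fintype F] (j : Fin 3) :
    {v : MarkoffSurface F | tripleCoord v.1 j = 0}.ncard ≤ 2 * Fintype.card F := by
  refine ncard_le_of_fibre_roots _ (fun v => tripleCoord v.1 (j + 1))
    (fun v => tripleCoord v.1 (j + 2)) (fun v hv w hw h => ?_) 2 fun b =>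
      ⟨X ^ 2 + C (b ^ 2), (monic_X_pow_add_C _ two_ne_zero).ne_zero,
        natDegree_X_pow_add_C.le, ?_⟩
  · exact markoffSurface_ext j (Eq.trans hv (Eq.symm hw)) (Prod.ext_iff.1 h).1 (Prod.ext_iff.1 h).2
  · rintro v hv rfl
    have h := tripleCoord_equation v j
    rw [Set.mem_ofPred_eq] at hv
    rw [hv] at h
    simp
    linear_combination h

open Polynomial in
theorem ncard_fixedPoints_ne_zero_le {F : Type*} [Field F] [Fintype F] (i j : Fin 3)
    (l : List (Fin 3)) (hl : (i :: l ++ [j]).IsChain (· ≠ ·)) (n : ℕ)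
    (hn : 6 * maxEntry ((i :: l).map markoffMatrix).prod ≤ n) :
    {v : MarkoffSurface F | (∀ k, tripleCoord v.1 k ≠ 0) ∧
      (i :: l).foldr vietaFun (tripleCoord v.1) = tripleCoord v.1}.ncard ≤
      2 * n * Fintype.card F := by
  refine ncard_le_of_fibre_roots _ (fun v => tripleCoord v.1 (j + 2) / tripleCoord v.1 (j + 1))
    (fun v => tripleCoord v.1 j / tripleCoord v.1 (j + 1)) ?_ _ fun c => ?_
  · rintro v ⟨hv, -⟩ w ⟨hw, -⟩ h
    obtain ⟨hc, hr⟩ := Prod.ext_iff.1 h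
    have hv0 := hv j
    have hw0 := hw j
    have hv1 := hv (j + 1)
    have hw1 := hw (j + 1)
    have hv2 := hv (j + 2)
    have hw2 := hw (j + 2)
    have ev := tripleCoord_equation v j
    have ew := tripleCoord_equation w j
    simp only at hc hr
    set x := tripleCoord v.1
    set y := tripleCoord w.1
    obtain ⟨c, hc'⟩ : ∃ c, c = x (j + 2) / x (j + 1) := ⟨_, rfl⟩
    obtain ⟨r, hr'⟩ : ∃ r, r = x j / x (j + 1) := ⟨_, rfl⟩
    rw [← hc', eq_div_iff hw1] at hc
    rw [← hr', eq_div_iff hw1] at hr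
    rw [eq_div_iff hv1] at hc' hr'
    have hc0 : c ≠ 0 := fun h => hv2 (by rw [← hc', h, zero_mul])
    have hr0 : r ≠ 0 := fun h => hv0 (by rw [← hr', h, zero_mul])
    rw [← hc', ← hr'] at ev
    rw [← hc, ← hr] at ew
    -- Dividing the Markoff equation by `t ^ 2` leaves a linear equation for `t`, so the two ratios
    -- determine the point.
    have key : ∀ t : F, t ≠ 0 → (r * t) ^ 2 + t ^ 2 + (c * t) ^ 2 = r * t * t * (c * t) →
        r * c * t = r ^ 2 + 1 + c ^ 2 := fun t ht h =>
      mul_left_cancel₀ (pow_ne_zero 2 ht) (by linear_combination -h)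
    have h1 : x (j + 1) = y (j + 1) :=
      mul_left_cancel₀ (mul_ne_zero hr0 hc0) ((key _ hv1 ev).trans (key _ hw1 ew).symm)
    have h0 : x j = y j := by rw [← hr, ← hr', h1]
    have h2 : x (j + 2) = y (j + 2) := by rw [← hc, ← hc', h1]
    exact markoffSurface_ext j h0 h1 h2
  · by_cases hc : c = 0
    -- No point with nonzero coordinates has ratio `0`; the constant `1` serves for this empty
    -- fibre.
    · refine ⟨1, one_ne_zero, by simp, ?_⟩
      rintro v ⟨hv, -⟩ h
      exact absurd (h.trans hc) (div_ne_zero (hv _) (hv _))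
    obtain ⟨e, Q, -, hlt, hQ, hu, hv⟩ := reduced_word_growth (isSumTriple_initialWeight j)
      (natDegree_initialNumerator hc j) (initialWeight_eq_slopeLength j) l i hl
    have hle := (isSumTriple_initialWeight j).le i
    have hen : e i ≤ n := by
      have h1 := hu i
      have h2 := slopeLength_le ((i :: l).map markoffMatrix).prod j i
      exact_mod_cast h1.le.trans (h2.trans hn)
    -- Over the common denominator `X ^ e i`, the original coordinate has numerator of degree at
    -- most `e i + initialWeight j i`, below `2 * e i` by strict growth.
    have hdeg : (X ^ (e i - initialWeight j i) * initialNumerator c j i).natDegree <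
        (Q i).natDegree := by
      refine natDegree_mul_le.trans_lt ?_
      rw [natDegree_X_pow, natDegree_initialNumerator hc, hQ]
      lia
    have hsub := natDegree_sub_eq_left_of_natDegree_lt hdeg
    refine ⟨Q i - X ^ (e i - initialWeight j i) * initialNumerator c j i, fun h => ?_, ?_, ?_⟩
    · rw [h, natDegree_zero, hQ] at hsub
      lia
    · rw [hsub, hQ]
      lia
    · rintro v ⟨hv0, hfix⟩ rfl
      have h1 := eval_initialNumerator j hv0 (tripleCoord_equation v j)
      have h2 := hv _ _ h1 i
      rw [hfix] at h2
      rw [eval_sub, ← h2, eval_mul, ← h1, eval_pow, eval_X, ← mul_assoc, ← pow_add,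
        Nat.sub_add_cancel (by lia), sub_self]

/-- A linear bound for the number of fixed points of an element of the Markoff group over any
finite field. -/
theorem ncard_fixedPoints_markoffAction_le (F : Type*) [Field F] [Fintype F] (g : MarkoffGroup)
    (hg : g ≠ 1) (A : GL (Fin 2) ℤ) (hA : (A : PGL2Z) = (g : PGL2Z)) :
    ((Function.fixedPoints (markoffAction F g)).ncard : ℤ) ≤
      (12 * maxEntry (A : Matrix (Fin 2) (Fin 2) ℤ) + 6) * Fintype.card F := by
  obtain ⟨l, hl, rfl⟩ := markoffGroup_exists_reduced g
  rcases l with _ | ⟨i, l⟩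
  · exact absurd rfl hg
  -- The last letter acts first, so it must differ from the index `j` of the largest initial weight.
  obtain ⟨j, hj⟩ : ∃ j, (i :: l ++ [j]).IsChain (· ≠ ·) := by
    refine ⟨(i :: l).getLast (by simp) + 1, List.isChain_append.2 ⟨hl, by simp, ?_⟩⟩
    intro x hx y hy
    rw [List.getLast?_eq_getLast_of_ne_nil (by simp), Option.mem_some_iff] at hx
    simp only [List.head?_cons, Option.mem_some_iff] at hy
    subst hx hy
    generalize (i :: l).getLast _ = x
    revert x; decide
  have hM : maxEntry A.1 = maxEntry ((i :: l).map markoffMatrix).prod := by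
    rw [← coe_prod_markoffGL]
    exact maxEntry_eq_of_mk_eq (hA.trans (mk_prod_markoffGL _).symm)
  have hpos := one_le_maxEntry A
  obtain ⟨n, hn⟩ := Int.eq_ofNat_of_zero_le (show 0 ≤ 6 * maxEntry A.1 by lia)
  have hgen := ncard_fixedPoints_ne_zero_le (F := F) i j l hj n (by rw [← hM, hn])
  have hcover : Function.fixedPoints (markoffAction F ((i :: l).map markoffGen).prod) ⊆
      {v : MarkoffSurface F | (∀ k, tripleCoord v.1 k ≠ 0) ∧
        (i :: l).foldr vietaFun (tripleCoord v.1) = tripleCoord v.1} ∪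
      ({v | tripleCoord v.1 0 = 0} ∪ ({v | tripleCoord v.1 1 = 0} ∪
        {v | tripleCoord v.1 2 = 0})) := by
    intro v hv
    by_cases h : ∀ k, tripleCoord v.1 k ≠ 0
    · refine Or.inl ⟨h, ?_⟩
      rw [← markoffAction_list_prod, show _ = v from hv]
    · push Not at h
      obtain ⟨k, hk⟩ := h
      right
      fin_cases k
      · exact Or.inl hk
      · exact Or.inr (Or.inl hk)
      · exact Or.inr (Or.inr hk)
  have h0 := ncard_coord_eq_zero_le F 0
  have h1 := ncard_coord_eq_zero_le F 1
  have h2 := ncard_coord_eq_zero_le F 2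
  have hall := ((Set.ncard_le_ncard hcover (Set.toFinite _)).trans (Set.ncard_union_le _ _)).trans
    (Nat.add_le_add hgen ((Set.ncard_union_le _ _).trans (Nat.add_le_add h0
      ((Set.ncard_union_le _ _).trans (Nat.add_le_add h1 h2)))))
  have hnat : (2 * n * Fintype.card F + (2 * Fintype.card F + (2 * Fintype.card F +
      2 * Fintype.card F)) : ℤ) = (12 * maxEntry A.1 + 6) * Fintype.card F := by
    rw [show (12 * maxEntry A.1 : ℤ) = 2 * n by linarith]
    ring
  rw [← hnat]
  exact_mod_cast hall

theorem theorem6p1 (p : ℕ) [Fact p.Prime] (g : MarkoffGroup) (hg : g ≠ 1)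
    (A : GL (Fin 2) ℤ) (hA : (A : PGL2Z) = (g : PGL2Z))
    (hM : (maxEntry (A : Matrix (Fin 2) (Fin 2) ℤ) : ℝ) ≤ ((p : ℝ) / 128) ^ ((1 : ℝ) / 8)) :
    ((Function.fixedPoints (markoffAction (ZMod p) g)).ncard : ℝ) ≤
      1024 * (p : ℝ) * (maxEntry (A : Matrix (Fin 2) (Fin 2) ℤ) : ℝ) ^ 8 := by
  have hbound := ncard_fixedPoints_markoffAction_le (ZMod p) g hg A hA
  rw [ZMod.card] at hbound
  have hpos : (1 : ℝ) ≤ (maxEntry (A : Matrix (Fin 2) (Fin 2) ℤ) : ℝ) := by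
    exact_mod_cast one_le_maxEntry A
  have hreal : ((Function.fixedPoints (markoffAction (ZMod p) g)).ncard : ℝ) ≤
      (12 * (maxEntry (A : Matrix (Fin 2) (Fin 2) ℤ) : ℝ) + 6) * p := by
    exact_mod_cast hbound
  -- With `M` the largest entry, `12 M + 6 ≤ 18 M ≤ 18 M ^ 8` since `M ≥ 1`.
  have hpow := le_self_pow₀ hpos (show 8 ≠ 0 by norm_num)
  refine hreal.trans ?_
  rw [mul_comm (1024 : ℝ), mul_assoc, mul_comm]
  gcongr
  linarith
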